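/- Graphs are finite and simple, and a matching is a set of pairwise disjoint edges. For a matching $M$ of a graph $G$ let $V(M)$ be the set of vertices saturated (covered) by $M$; the vertices outside $V(M)$ are exposed by $M$. A matching is maximal if it is contained in no other matching. Let $\nu(G)$ be the maximum size of a matching of $G$, $\beta(G)$ the minimum size of a maximal matching of $G$, and $\mu(G)=\nu(G)-\beta(G)$ the matching gap. Let $D(G)$ be the set of vertices of $G$ left exposed by at least one maximum matching, $A(G)$ the set of vertices of $V(G)\setminus D(G)$ with at least one neighbour in $D(G)$, and $C(G)=V(G)\setminus(D(G)\cup A(G))$. Write $G[S]$ for the subgraph induced by $S\subseteq V(G)$, and $N(v)$ for the set of neighbours of $v$ in $G$. Theorem. Let $G$ be a graph and $k$ a non-negative integer. Then $\mu(G)\ge k$ if and only if $G$ contains an independent set $I$ and two matchings $M_A$ and $M_A^*$ such that (i) $|I|=2k$; (ii) $M_A$ is an inclusion-wise minimal matching among those saturating $A(G)\setminus I$ and exposing $I$ (that is, covering every vertex of $A(G)\setminus I$ and no vertex of $I$); (iii) $M_A^*$ consists of $|A(G)|$ edges, each of which joins a vertex of $A(G)$ to a vertex of a connected component of $G[D(G)]$,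 the components belonging to different edges being distinct; (iv) if $X$ is (the vertex set of) a connected component of $G[C(G)]$, or a connected component of $G[D(G)]$ containing a vertex of $V(M_A^*)$, then $G[X\setminus(I\cup V(M_A))]$ has a perfect matching; and (v) if $X$ is (the vertex set of) a connected component of $G[D(G)]$ containing no vertex of $V(M_A^*)$, then $G[X\setminus(I\cup V(M_A))]$ has a matching that leaves exactly one vertex $v_X$ of $X\setminus(I\cup V(M_A))$ exposed, and this vertex satisfies $N(v_X)\cap I=\emptyset$. -/

import Mathlib

namespace SimpleGraph

variable {V : Type*} (G : SimpleGraph V)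

/-- Maximal matchings. A matching is a subgraph `M` with `M.IsMatching`; its saturated vertices are
exactly `M.verts`, its exposed vertices are the others, and for matchings `≤` is inclusion of
edge sets. -/
def IsMaximalMatching (M : G.Subgraph) : Prop :=
  Maximal (fun N : G.Subgraph => N.IsMatching) M

/-- Matchings of maximum size. -/
def IsMaximumMatching (M : G.Subgraph) : Prop :=
  M.IsMatching ∧ ∀ N : G.Subgraph, N.IsMatching → N.edgeSet.ncard ≤ M.edgeSet.ncard

/-- The matching number `ν(G)`: the maximum size of a matching. -/
noncomputable def matchingNumber : ℕ :=
  sSup {n | ∃ M : G.Subgraph, M.IsMatching ∧ M.edgeSet.ncard = n}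

/-- The number `β(G)`: the minimum size of a maximal matching. -/
noncomputable def minMaximalMatchingNumber : ℕ :=
  sInf {n | ∃ M : G.Subgraph, G.IsMaximalMatching M ∧ M.edgeSet.ncard = n}

/-- In a finite graph `β(G) ≤ ν(G)`, so the subtraction in `matchingGap` does not truncate. -/
theorem minMaximalMatchingNumber_le_matchingNumber [Finite V] :
    G.minMaximalMatchingNumber ≤ G.matchingNumber := by
  have hbot : (⊥ : G.Subgraph).IsMatching := fun v hv => by simp at hv
  obtain ⟨M, -, hM⟩ := (Set.toFinite {N : G.Subgraph | N.IsMatching}).exists_le_maximal hbot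
  have hle : G.minMaximalMatchingNumber ≤ M.edgeSet.ncard := Nat.sInf_le ⟨M, hM, rfl⟩
  have hbdd : BddAbove {n | ∃ N : G.Subgraph, N.IsMatching ∧ N.edgeSet.ncard = n} := by
    refine ⟨G.edgeSet.ncard, ?_⟩
    rintro n ⟨N, -, rfl⟩
    exact Set.ncard_le_ncard N.edgeSet_subset (Set.toFinite _)
  exact hle.trans (le_csSup hbdd ⟨M, hM.1, rfl⟩)

/-- The matching gap `μ(G) = ν(G) - β(G)`. -/
noncomputable def matchingGap : ℕ :=
  G.matchingNumber - G.minMaximalMatchingNumber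

/-- `D(G)`: the vertices exposed by at least one maximum matching. -/
def gallaiEdmondsD : Set V :=
  {v | ∃ M : G.Subgraph, G.IsMaximumMatching M ∧ v ∉ M.verts}

/-- `A(G)`: the vertices outside `D(G)` with at least one neighbour in `D(G)`. -/
def gallaiEdmondsA : Set V :=
  {v | v ∉ G.gallaiEdmondsD ∧ ∃ w ∈ G.gallaiEdmondsD, G.Adj v w}

/-- `C(G)`: the remaining vertices. -/
def gallaiEdmondsC : Set V :=
  (G.gallaiEdmondsD ∪ G.gallaiEdmondsA)ᶜ

/-- `X` is the vertex set of a connected component of the induced subgraph `G[U]`. -/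
def IsInducedComponent (U X : Set V) : Prop :=
  ∃ K : (G.induce U).ConnectedComponent, X = Subtype.val '' K.supp

/-- The induced subgraph `G[S]` has a perfect matching. -/
def InducedHasPerfectMatching (S : Set V) : Prop :=
  ∃ M : (G.induce S).Subgraph, M.IsPerfectMatching

/-- The matching `N` consists of `|A(G)|` edges, each of which joins a vertex of `A(G)` to a vertex
of a component of `G[D(G)]`, the components of different edges being different. -/
def MatchesAIntoDistinctDComponents (N : G.Subgraph) : Prop :=
  N.edgeSet.ncard = G.gallaiEdmondsA.ncard ∧
  ∃ X : N.edgeSet → Set V, Function.Injective X ∧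
    ∀ e : N.edgeSet, G.IsInducedComponent G.gallaiEdmondsD (X e) ∧
      ∃ a ∈ G.gallaiEdmondsA, ∃ d ∈ X e, (e : Sym2 V) = s(a, d)

end SimpleGraph

/-! The argument runs on matchable sets: the vertex sets saturated by matchings. A matching is
maximal exactly when its exposed vertices are independent, so a gap of at least `k` means that some
matchable `S` with independent complement is at least `2 * k` vertices smaller than a maximum one.
The engine is the symmetric exchange property `IsMatchable.exchange`. It yields extension to a
maximum set, interpolation of sizes, and the Gallai–Edmonds facts needed: deleting `A(G)` preserves
`D(G)`, and a maximum matching of `G - A(G)` exposes exactly one vertex in each component of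
`G[D(G)]`.

From a gap to the certificate: extend `S` to a maximum `T` and enlarge `S` inside `T` until `|T \ S|
= 2 * k`. Put `I = T \ S`; the two matchings are the edges meeting `A(G)` of a matching on `S` and
of a matching on `T`. The remaining edges of the first stay inside components of `G - A(G)`, and
`v_X` is the vertex of `X` outside `T`.

Conversely, `M_A` together with the matchings inside the components saturates the complement of `I`
and of all the `v_X`. That exposed set is independent. By `ncard_compl_add_ncard_gallaiEdmondsA_le`
and `MatchesAIntoDistinctDComponents.ncard_components_le`, there are at least as many `v_X` as
vertices exposed by a maximum matching, so the deficit is at least `2 * k`. -/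

namespace SimpleGraph

variable {V : Type*} {G : SimpleGraph V}

/-! ### Matchable sets and symmetric exchange -/

/-- `S` is the set of vertices saturated by some matching of `G`. -/
def IsMatchable (G : SimpleGraph V) (S : Set V) : Prop :=
  ∃ M : G.Subgraph, M.IsMatching ∧ M.verts = S

theorem Subgraph.IsMatching.isMatchable {M : G.Subgraph} (hM : M.IsMatching) :
    G.IsMatchable M.verts := ⟨M, hM, rfl⟩

theorem isMatchable_empty : G.IsMatchable ∅ :=
  ⟨⊥, fun v hv => by simp at hv, rfl⟩

/-- A set closed under taking partners inherits a matching. -/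
theorem Subgraph.IsMatching.induce_of_closed {M : G.Subgraph} (hM : M.IsMatching) {Y : Set V}
    (hY : Y ⊆ M.verts) (hcl : ∀ ⦃u w⦄, u ∈ Y → M.Adj u w → w ∈ Y) :
    (M.induce Y).IsMatching := by
  intro v hv
  obtain ⟨w, hw, huniq⟩ := hM (hY hv)
  exact ⟨w, ⟨hv, hcl hv hw, hw⟩, fun y hy => huniq y hy.2.2⟩

theorem IsMatchable.union {S T : Set V} (hS : G.IsMatchable S) (hT : G.IsMatchable T)
    (hd : Disjoint S T) : G.IsMatchable (S ∪ T) := by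
  obtain ⟨M, hM, rfl⟩ := hS
  obtain ⟨N, hN, rfl⟩ := hT
  exact ⟨M ⊔ N, hM.sup hN (by rwa [hM.support_eq_verts, hN.support_eq_verts]), rfl⟩

theorem IsMatchable.iUnion {ι : Type*} {S : ι → Set V} (hS : ∀ i, G.IsMatchable (S i))
    (hd : Pairwise fun i j => Disjoint (S i) (S j)) : G.IsMatchable (⋃ i, S i) := by
  choose M hM hv using hS
  refine ⟨⨆ i, M i, .iSup hM fun i j hij => ?_, by simp [hv]⟩
  change Disjoint _ _
  rw [(hM i).support_eq_verts, (hM j).support_eq_verts, hv, hv]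
  exact hd hij

theorem Adj.isMatchable_pair {a b : V} (h : G.Adj a b) : G.IsMatchable {a, b} :=
  ⟨G.subgraphOfAdj h, .subgraphOfAdj h, rfl⟩

/-- Removing one edge from a matching. -/
theorem IsMatchable.exists_adj_diff {S : Set V} (hS : G.IsMatchable S) {x : V} (hx : x ∈ S) :
    ∃ y ∈ S, G.Adj x y ∧ G.IsMatchable (S \ {x, y}) := by
  obtain ⟨M, hM, rfl⟩ := hS
  obtain ⟨y, hy, -⟩ := hM hx
  refine ⟨y, hy.snd_mem, hy.adj_sub,
    ⟨_, hM.induce_of_closed Set.sdiff_subset fun u w hu huw => ⟨huw.snd_mem, ?_⟩, rfl⟩⟩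
  rintro (rfl | rfl)
  · exact hu.2 (Or.inr (hM.eq_of_adj_left huw.symm hy))
  · exact hu.2 (Or.inl (hM.eq_of_adj_right huw hy))

theorem IsMatchable.even_ncard [Finite V] {S : Set V} (hS : G.IsMatchable S) : Even S.ncard := by
  classical
  obtain ⟨M, hM, rfl⟩ := hS
  have := Fintype.ofFinite M.verts
  rw [Set.ncard_eq_toFinset_card']
  exact hM.even_card

theorem two_mul_ncard_edgeSet_of_existsUnique_adj {W : Type*} [Finite W] {H : SimpleGraph W}
    (h : ∀ v, ∃! w, H.Adj v w) : 2 * H.edgeSet.ncard = Nat.card W := by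
  classical
  have := Fintype.ofFinite W
  rw [← coe_edgeFinset, Set.ncard_coe_finset, ← sum_degrees_eq_twice_card_edges,
    Finset.sum_congr rfl fun v _ => degree_eq_one_iff_existsUnique_adj.2 (h v)]
  simp

theorem Subgraph.IsMatching.two_mul_ncard_edgeSet [Finite V] {M : G.Subgraph}
    (hM : M.IsMatching) : 2 * M.edgeSet.ncard = M.verts.ncard := by
  rw [← Subgraph.image_coe_edgeSet_coe,
    Set.ncard_image_of_injective _ (Sym2.map.injective Subtype.val_injective),
    ← Nat.card_coe_set_eq M.verts]
  refine two_mul_ncard_edgeSet_of_existsUnique_adj fun v => ?_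
  obtain ⟨w, hw, huniq⟩ := hM v.2
  exact ⟨⟨w, hw.snd_mem⟩, hw, fun y hy => Subtype.ext (huniq y hy)⟩

/-- The symmetric exchange property of matchable sets. -/
theorem IsMatchable.exchange [Finite V] {S T : Set V} (hS : G.IsMatchable S)
    (hT : G.IsMatchable T) {x : V} (hxS : x ∈ S) (hxT : x ∉ T) :
    (∃ y ∈ S, y ∉ T ∧ y ≠ x ∧ G.IsMatchable (S \ {x, y}) ∧ G.IsMatchable (T ∪ {x, y})) ∨
    (∃ y ∈ T, y ∉ S ∧ G.IsMatchable (insert y (S \ {x})) ∧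
      G.IsMatchable (insert x (T \ {y}))) := by
  induction hn : S.ncard using Nat.strong_induction_on generalizing S T x with
  | _ n ih =>
  obtain ⟨a, haS, hxa, hS1⟩ := hS.exists_adj_diff hxS
  have hlt : (S \ {x, a}).ncard < n := by
    rw [← hn]
    exact Set.ncard_lt_ncard ⟨Set.sdiff_subset, fun h => (h hxS).2 (by simp)⟩ (Set.toFinite _)
  replace ih := fun (T' : Set V) hT' b => ih _ hlt hS1 (T := T') hT' (x := b)
  by_cases haT : a ∈ T
  swap
  · clear ih
    refine Or.inl ⟨a, haS, haT, hxa.ne', hS1, hT.union hxa.isMatchable_pair ?_⟩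
    rw [Set.disjoint_left]; grind
  obtain ⟨b, hbT, hab, hT1⟩ := hT.exists_adj_diff haT
  have hbx : b ≠ x := by grind
  have hba : b ≠ a := hab.ne'
  have hax : a ≠ x := hxa.ne'
  by_cases hbS : b ∈ S
  swap
  · clear ih
    refine Or.inr ⟨b, hbT, hbS, ?_, ?_⟩
    · convert hS1.union hab.isMatchable_pair (by rw [Set.disjoint_left]; grind) using 1
      ext v; grind
    · convert hT1.union hxa.isMatchable_pair (by rw [Set.disjoint_left]; grind) using 1
      ext v; grind
  -- Follow the alternating path `x`, `a`, `b`: delete the edge `xa` on the `S` side and `ab` on the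
  -- `T` side, recurse from `b`, then restore the two edges on swapped sides.
  replace ih := ih _ hT1 b (by grind) (by grind) rfl
  rcases ih with
    ⟨y, hyS, hyT, hyb, h1, h2⟩ | ⟨y, hyT, hyS, h1, h2⟩
  · refine Or.inl ⟨y, by grind, by grind, by grind, ?_, ?_⟩
    · convert h1.union hab.isMatchable_pair (by rw [Set.disjoint_left]; grind) using 1
      ext v; grind
    · convert h2.union hxa.isMatchable_pair (by rw [Set.disjoint_left]; grind) using 1
      ext v; grind
  · refine Or.inr ⟨y, by grind, by grind, ?_, ?_⟩
    · convert h1.union hab.isMatchable_pair (by rw [Set.disjoint_left]; grind) using 1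
      ext v; grind
    · convert h2.union hxa.isMatchable_pair (by rw [Set.disjoint_left]; grind) using 1
      ext v; grind

/-! ### Maximum matchable sets and Gallai's lemma -/

/-- `S` is a largest matchable subset of `W`, i.e. the set of saturated vertices of a maximum
matching of `G[W]`. -/
def IsMaxMatchableIn (G : SimpleGraph V) (W S : Set V) : Prop :=
  S ⊆ W ∧ G.IsMatchable S ∧ ∀ T ⊆ W, G.IsMatchable T → T.ncard ≤ S.ncard

/-- The vertices of `W` exposed by at least one maximum matching of `G[W]`. -/
def missedIn (G : SimpleGraph V) (W : Set V) : Set V :=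
  {v | v ∈ W ∧ ∃ S, G.IsMaxMatchableIn W S ∧ v ∉ S}

theorem exists_isMaxMatchableIn [Finite V] (G : SimpleGraph V) (W : Set V) :
    ∃ S, G.IsMaxMatchableIn W S := by
  obtain ⟨S, ⟨hSW, hS⟩, hmax⟩ :=
    (Set.toFinite {S : Set V | S ⊆ W ∧ G.IsMatchable S}).exists_maximalFor Set.ncard _
      ⟨∅, Set.empty_subset _, isMatchable_empty⟩
  refine ⟨S, hSW, hS, fun T hTW hT => ?_⟩
  by_contra! h
  exact absurd (hmax ⟨hTW, hT⟩ h.le) (not_le.2 h)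

theorem IsMaxMatchableIn.of_ncard_le {W S T : Set V} (hS : G.IsMaxMatchableIn W S) (hTW : T ⊆ W)
    (hT : G.IsMatchable T) (h : S.ncard ≤ T.ncard) : G.IsMaxMatchableIn W T :=
  ⟨hTW, hT, fun R hRW hR => (hS.2.2 R hRW hR).trans h⟩

theorem IsMaxMatchableIn.ncard_eq {W S T : Set V} (hS : G.IsMaxMatchableIn W S)
    (hT : G.IsMaxMatchableIn W T) : S.ncard = T.ncard :=
  le_antisymm (hT.2.2 _ hS.1 hS.2.1) (hS.2.2 _ hT.1 hT.2.1)

theorem ncard_union_pair [Finite V] {T : Set V} {x y : V} (hx : x ∉ T) (hy : y ∉ T)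
    (hxy : x ≠ y) : (T ∪ {x, y}).ncard = T.ncard + 2 := by
  rw [Set.ncard_union_eq (by rw [Set.disjoint_left]; grind) (Set.toFinite _) (Set.toFinite _),
    Set.ncard_pair hxy]

theorem ncard_insert_diff [Finite V] {S : Set V} {x y : V} (hx : x ∈ S) (hy : y ∉ S) :
    (insert y (S \ {x})).ncard = S.ncard := by
  rw [Set.ncard_insert_of_notMem (by grind) (Set.toFinite _),
    Set.ncard_sdiff_singleton_add_one hx (Set.toFinite _)]

/-- Removing a vertex that every maximum matching saturates and that has a neighbour which some
maximum matching exposes. -/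
theorem missedIn_diff_singleton [Finite V] {W : Set V} {a d : V} (haW : a ∈ W)
    (ha : a ∉ G.missedIn W) (hd : d ∈ G.missedIn W) (had : G.Adj a d) :
    G.missedIn (W \ {a}) = G.missedIn W ∧
      ∀ S T, G.IsMaxMatchableIn W S → G.IsMaxMatchableIn (W \ {a}) T →
        S.ncard = T.ncard + 2 := by
  have hcov : ∀ S, G.IsMaxMatchableIn W S → a ∈ S := by
    intro S hS
    by_contra h
    exact ha ⟨haW, S, hS, h⟩
  have hdel : ∀ S, G.IsMaxMatchableIn W S →
      ∃ R ⊆ S, R ⊆ W \ {a} ∧ G.IsMatchable R ∧ S.ncard = R.ncard + 2 := by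
    intro S hS
    obtain ⟨b, hbS, hab, hR⟩ := hS.2.1.exists_adj_diff (hcov S hS)
    have := hS.1
    refine ⟨_, Set.sdiff_subset, by grind, hR, ?_⟩
    rw [← ncard_union_pair (x := a) (y := b) (by simp) (by simp) hab.ne]
    congr 1
    have := hcov S hS
    ext v; grind
  have hcard : ∀ S T, G.IsMaxMatchableIn W S → G.IsMaxMatchableIn (W \ {a}) T →
      S.ncard = T.ncard + 2 := by
    intro S T hS hT
    obtain ⟨R, -, hRW, hR, hSR⟩ := hdel S hS
    have h1 := hT.2.2 R hRW hR
    have h2 := hS.2.2 T (hT.1.trans Set.sdiff_subset) hT.2.1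
    -- Deleting `a` costs at most one edge, and it costs something because maximum sets contain `a`;
    -- parity makes the loss exactly 2.
    have h3 : T.ncard ≠ S.ncard := fun h =>
      (hT.1 (hcov T (hS.of_ncard_le (hT.1.trans Set.sdiff_subset) hT.2.1 h.ge))).2 rfl
    obtain ⟨p, hp⟩ := hS.2.1.even_ncard
    obtain ⟨q, hq⟩ := hT.2.1.even_ncard
    omega
  refine ⟨Set.Subset.antisymm ?_ ?_, hcard⟩
  · rintro x ⟨⟨hxW, hxa⟩, T, hT, hxT⟩
    by_contra hx
    have hcovx : ∀ S, G.IsMaxMatchableIn W S → x ∈ S := by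
      intro S hS
      by_contra h
      exact hx ⟨hxW, S, hS, h⟩
    obtain ⟨hdW, S, hS, hdS⟩ := hd
    have hST := hcard S T hS hT
    have hTa := hT.1
    have hSW := hS.1
    have haT : a ∉ T := fun h => (hT.1 h).2 rfl
    -- Growing `T` by `{x, y}` makes it maximum in `W`, so `y = a`; then trading `a`'s partnership
    -- for the edge `ad` gives a maximum set avoiding `x`. The other outcome avoids `x` directly.
    rcases hS.2.1.exchange hT.2.1 (hcovx S hS) hxT with
      ⟨y, hyS, hyT, hyx, h1, h2⟩ | ⟨y, hyT, hyS, h1, -⟩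
    · have hmax : G.IsMaxMatchableIn W (T ∪ {x, y}) := by
        refine hS.of_ncard_le (by grind) h2 ?_
        rw [ncard_union_pair hxT hyT hyx.symm, hST]
      have hya : y = a := by
        have := hcov _ hmax
        grind
      subst hya
      have h3 := h1.union had.isMatchable_pair (by rw [Set.disjoint_left]; grind)
      have h4 : S \ {x, y} ∪ {y, d} = insert d (S \ {x}) := by
        ext v; grind
      rw [h4] at h3
      have := hcovx _ (hS.of_ncard_le (by grind) h3
        (ncard_insert_diff (hcovx S hS) hdS).ge)
      grind
    · have := hcovx _ (hS.of_ncard_le (by grind) h1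
        (ncard_insert_diff (hcovx S hS) hyS).ge)
      grind
  · rintro x ⟨hxW, S, hS, hxS⟩
    have hxa : x ≠ a := fun h => hxS (h ▸ hcov S hS)
    obtain ⟨R, hRS, hRW, hR, hSR⟩ := hdel S hS
    refine ⟨⟨hxW, hxa⟩, R, ⟨hRW, hR, fun T hTW hT => ?_⟩, fun h => hxS (hRS h)⟩
    obtain ⟨T', hT'⟩ := G.exists_isMaxMatchableIn (W \ {a})
    have := hcard S T' hS hT'
    have := hT'.2.2 T hTW hT
    omega

/-- Gallai's transitivity lemma. -/
theorem not_exists_isMaxMatchableIn_trans [Finite V] {W : Set V} {x y z : V} (hxz : x ≠ z)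
    (hy : y ∈ G.missedIn W) (hxy : ∀ S, G.IsMaxMatchableIn W S → x ∈ S ∨ y ∈ S)
    (hyz : ∀ S, G.IsMaxMatchableIn W S → y ∈ S ∨ z ∈ S) :
    ∀ S, G.IsMaxMatchableIn W S → x ∈ S ∨ z ∈ S := by
  intro S hS
  by_contra! hmiss
  have hyS : y ∈ S := (hxy S hS).resolve_left hmiss.1
  obtain ⟨hyW, T, hT, hyT⟩ := hy
  have hSW := hS.1
  have hTW := hT.1
  -- `T` cannot grow, so `y` is replaced in `S` by a single `w`. The new maximum set misses `y`,
  -- hence must contain both `x` and `z`, though only one vertex was added.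
  rcases hS.2.1.exchange hT.2.1 hyS hyT with ⟨w, hwS, hwT, hwy, -, h2⟩ | ⟨w, hwT, hwS, h1, -⟩
  · have h3 := hT.2.2 _ (by grind) h2
    rw [ncard_union_pair hyT hwT hwy.symm] at h3
    omega
  · have hmax := hS.of_ncard_le (by grind) h1 (ncard_insert_diff hyS hwS).ge
    have h3 := hxy _ hmax
    have h4 := hyz _ hmax
    grind

/-- Every matchable set extends to the saturated set of a maximum matching. -/
theorem IsMatchable.exists_isMaxMatchableIn_superset [Finite V] {W S : Set V}
    (hS : G.IsMatchable S) (hSW : S ⊆ W) : ∃ T, G.IsMaxMatchableIn W T ∧ S ⊆ T := by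
  -- Among maximum sets take one missing as little of `S` as possible; an exchange would either
  -- enlarge `T` or trade a vertex outside `S` for one in `S`.
  obtain ⟨T, hT, hmin⟩ := (Set.toFinite {T | G.IsMaxMatchableIn W T}).exists_minimalFor
    (fun T => (S \ T).ncard) _ (G.exists_isMaxMatchableIn W)
  refine ⟨T, hT, fun x hxS => ?_⟩
  by_contra hxT
  have hTW := hT.1
  rcases hS.exchange hT.2.1 hxS hxT with ⟨y, hyS, hyT, hyx, -, h2⟩ | ⟨y, hyT, hyS, -, h2⟩
  · have h3 := hT.2.2 _ (by grind) h2
    rw [ncard_union_pair hxT hyT hyx.symm] at h3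
    omega
  · have hmax := hT.of_ncard_le (by grind) h2 (ncard_insert_diff hyT hxT).ge
    have hlt : (S \ insert x (T \ {y})).ncard < (S \ T).ncard :=
      Set.ncard_lt_ncard ⟨by grind, fun h => (h ⟨hxS, hxT⟩).2 (by simp)⟩ (Set.toFinite _)
    exact absurd (hmin hmax hlt.le) (not_le.2 hlt)

/-- Exchanging from `T` towards a subset `S` can only add a pair, since the other outcome needs a
vertex of `S \ T`. So `S` grows inside `T` in steps of 2. -/
theorem IsMatchable.exists_superset_ncard_eq [Finite V] {S T : Set V} (hS : G.IsMatchable S)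
    (hT : G.IsMatchable T) (hST : S ⊆ T) {m : ℕ} (hm : Even m) (hSm : S.ncard ≤ m)
    (hmT : m ≤ T.ncard) : ∃ R, G.IsMatchable R ∧ S ⊆ R ∧ R ⊆ T ∧ R.ncard = m := by
  induction hn : T.ncard - S.ncard using Nat.strong_induction_on generalizing S with
  | _ n ih =>
  rcases hSm.eq_or_lt with h | h
  · exact ⟨S, hS, subset_rfl, hST, h⟩
  obtain ⟨x, hxT, hxS⟩ : ∃ x ∈ T, x ∉ S := by
    by_contra! hc
    have := Set.ncard_le_ncard hc (Set.toFinite _)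
    omega
  rcases hT.exchange hS hxT hxS with ⟨y, hyT, hyS, hyx, -, h2⟩ | ⟨y, hyS, hyT, -⟩
  · have hc := ncard_union_pair hxS hyS hyx.symm
    obtain ⟨p, hp⟩ := hS.even_ncard
    obtain ⟨q, hq⟩ := hm
    obtain ⟨R, hR, hSR, hRT, hRm⟩ := ih (T.ncard - (S ∪ {x, y}).ncard) (by omega) h2
      (by grind) (by omega) rfl
    exact ⟨R, hR, Set.subset_union_left.trans hSR, hRT, hRm⟩
  · exact absurd (hST hyS) hyT

/-! ### Components of induced subgraphs -/

theorem IsInducedComponent.subset {U X : Set V} (h : G.IsInducedComponent U X) : X ⊆ U := by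
  obtain ⟨K, rfl⟩ := h
  rintro _ ⟨v, -, rfl⟩
  exact v.2

theorem IsInducedComponent.nonempty {U X : Set V} (h : G.IsInducedComponent U X) :
    X.Nonempty := by
  obtain ⟨K, rfl⟩ := h
  exact K.nonempty_supp.image _

theorem exists_isInducedComponent {U : Set V} {v : V} (hv : v ∈ U) :
    ∃ X, G.IsInducedComponent U X ∧ v ∈ X :=
  ⟨_, ⟨(G.induce U).connectedComponentMk ⟨v, hv⟩, rfl⟩, ⟨v, hv⟩, rfl, rfl⟩

theorem IsInducedComponent.eq_of_mem {U X Y : Set V} (hX : G.IsInducedComponent U X)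
    (hY : G.IsInducedComponent U Y) {v : V} (hvX : v ∈ X) (hvY : v ∈ Y) : X = Y := by
  obtain ⟨K, rfl⟩ := hX
  obtain ⟨L, rfl⟩ := hY
  obtain ⟨⟨v, hv⟩, hK, rfl⟩ := hvX
  obtain ⟨⟨w, hw⟩, hL, rfl⟩ := hvY
  rw [ConnectedComponent.mem_supp_iff] at hK hL
  rw [← hK, ← hL]

theorem IsInducedComponent.mem_of_adj {U X : Set V} (hX : G.IsInducedComponent U X) {u v : V}
    (hu : u ∈ X) (hv : v ∈ U) (huv : G.Adj u v) : v ∈ X := by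
  obtain ⟨K, rfl⟩ := hX
  obtain ⟨⟨u, hu'⟩, hK, rfl⟩ := hu
  refine ⟨⟨v, hv⟩, ?_, rfl⟩
  rw [ConnectedComponent.mem_supp_iff] at hK ⊢
  rw [← hK, ConnectedComponent.eq]
  exact Adj.reachable (G := G.induce U) (u := ⟨v, hv⟩) (v := ⟨u, hu'⟩) huv.symm

theorem IsInducedComponent.induction {U X : Set V} (hX : G.IsInducedComponent U X) {u v : V}
    (hu : u ∈ X) (hv : v ∈ X) {P : V → Prop} (hP : P u)
    (hstep : ∀ a ∈ U, ∀ b ∈ U, G.Adj a b → P a → P b) : P v := by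
  obtain ⟨K, rfl⟩ := hX
  obtain ⟨u, hu, rfl⟩ := hu
  obtain ⟨v, hv, rfl⟩ := hv
  obtain ⟨p⟩ := ConnectedComponent.exact (hu.trans hv.symm)
  clear hu hv
  induction p with
  | nil => exact hP
  | cons h p ih => exact ih (hstep _ (Subtype.property _) _ (Subtype.property _) h hP)

/-! ### The Gallai–Edmonds structure -/

theorem isMaximumMatching_iff [Finite V] {M : G.Subgraph} (hM : M.IsMatching) :
    G.IsMaximumMatching M ↔ G.IsMaxMatchableIn Set.univ M.verts := by
  constructor
  · rintro ⟨-, h⟩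
    refine ⟨Set.subset_univ _, hM.isMatchable, ?_⟩
    rintro _ - ⟨N, hN, rfl⟩
    rw [← hN.two_mul_ncard_edgeSet, ← hM.two_mul_ncard_edgeSet]
    have := h N hN
    omega
  · rintro ⟨-, -, h⟩
    refine ⟨hM, fun N hN => ?_⟩
    have := h _ (Set.subset_univ _) hN.isMatchable
    rw [← hN.two_mul_ncard_edgeSet, ← hM.two_mul_ncard_edgeSet] at this
    omega

theorem gallaiEdmondsD_eq_missedIn_univ [Finite V] :
    G.gallaiEdmondsD = G.missedIn Set.univ := by
  ext v
  constructor
  · rintro ⟨M, hM, hv⟩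
    exact ⟨trivial, _, (isMaximumMatching_iff hM.1).1 hM, hv⟩
  · rintro ⟨-, S, hS, hv⟩
    obtain ⟨M, hM, rfl⟩ := hS.2.1
    exact ⟨M, (isMaximumMatching_iff hM).2 hS, hv⟩

/-- The stability lemma, iterated: since each deletion leaves `D(G)` unchanged, the next vertex of
`B` still satisfies the hypotheses of `missedIn_diff_singleton`. -/
theorem missedIn_compl_of_subset_gallaiEdmondsA [Finite V] {B : Set V}
    (hB : B ⊆ G.gallaiEdmondsA) : G.missedIn Bᶜ = G.gallaiEdmondsD ∧
      ∀ S T, G.IsMaxMatchableIn Set.univ S → G.IsMaxMatchableIn Bᶜ T →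
        S.ncard = T.ncard + 2 * B.ncard := by
  induction B, Set.toFinite B using Set.Finite.induction_on with
  | empty =>
    rw [Set.compl_empty, gallaiEdmondsD_eq_missedIn_univ]
    exact ⟨rfl, fun S T hS hT => by simpa using hS.ncard_eq hT⟩
  | @insert a B haB _ ih =>
    obtain ⟨ih1, ih2⟩ := ih ((Set.subset_insert _ _).trans hB)
    obtain ⟨haD, d, hd, had⟩ := hB (Set.mem_insert a B)
    rw [← ih1] at haD hd
    obtain ⟨h1, h2⟩ := missedIn_diff_singleton (W := Bᶜ) haB haD hd had
    have hcompl : (insert a B)ᶜ = Bᶜ \ {a} := by ext v; simp [and_comm]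
    rw [hcompl, h1, ih1]
    refine ⟨rfl, fun S T hS hT => ?_⟩
    obtain ⟨R, hR⟩ := G.exists_isMaxMatchableIn Bᶜ
    rw [ih2 S R hS hR, h2 R T hR hT, Set.ncard_insert_of_notMem haB (Set.toFinite _)]
    ring

theorem missedIn_compl_gallaiEdmondsA [Finite V] :
    G.missedIn G.gallaiEdmondsAᶜ = G.gallaiEdmondsD :=
  (missedIn_compl_of_subset_gallaiEdmondsA subset_rfl).1

theorem IsMaxMatchableIn.ncard_eq_add [Finite V] {S T : Set V}
    (hS : G.IsMaxMatchableIn Set.univ S) (hT : G.IsMaxMatchableIn G.gallaiEdmondsAᶜ T) :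
    S.ncard = T.ncard + 2 * G.gallaiEdmondsA.ncard :=
  (missedIn_compl_of_subset_gallaiEdmondsA subset_rfl).2 S T hS hT

theorem IsMaxMatchableIn.mem_gallaiEdmondsD [Finite V] {S : Set V}
    (hS : G.IsMaxMatchableIn G.gallaiEdmondsAᶜ S) {v : V} (hvA : v ∉ G.gallaiEdmondsA)
    (hvS : v ∉ S) : v ∈ G.gallaiEdmondsD := by
  rw [← missedIn_compl_gallaiEdmondsA]
  exact ⟨hvA, S, hS, hvS⟩

theorem disjoint_gallaiEdmondsA_gallaiEdmondsD :
    Disjoint G.gallaiEdmondsA G.gallaiEdmondsD :=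
  Set.disjoint_left.2 fun _ h => h.1

/-- A maximum matching of `G - A(G)` exposes at most one vertex of each component of `G[D(G)]`. -/
theorem IsMaxMatchableIn.eq_of_notMem [Finite V] {S X : Set V}
    (hS : G.IsMaxMatchableIn G.gallaiEdmondsAᶜ S)
    (hX : G.IsInducedComponent G.gallaiEdmondsD X) {u v : V} (hu : u ∈ X) (hv : v ∈ X)
    (huS : u ∉ S) (hvS : v ∉ S) : u = v := by
  -- Adjacent vertices of `D(G)` are never both exposed, as their edge could be added; transitivity
  -- carries this along a path in the component.
  have key : u = v ∨ ∀ R, G.IsMaxMatchableIn G.gallaiEdmondsAᶜ R → u ∈ R ∨ v ∈ R := by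
    refine hX.induction hu hv
      (P := fun v => u = v ∨ ∀ R, G.IsMaxMatchableIn G.gallaiEdmondsAᶜ R → u ∈ R ∨ v ∈ R)
      (Or.inl rfl) fun a ha b hb hab h => ?_
    have haA := Set.disjoint_right.1 disjoint_gallaiEdmondsA_gallaiEdmondsD ha
    have hbA := Set.disjoint_right.1 disjoint_gallaiEdmondsA_gallaiEdmondsD hb
    have hab' : ∀ R, G.IsMaxMatchableIn G.gallaiEdmondsAᶜ R → a ∈ R ∨ b ∈ R := by
      intro R hR
      by_contra! hc
      have h1 := hR.2.2 _ (Set.union_subset hR.1 (Set.pair_subset haA hbA))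
        (hR.2.1.union hab.isMatchable_pair (by rw [Set.disjoint_left]; grind))
      rw [ncard_union_pair hc.1 hc.2 hab.ne] at h1
      omega
    rcases h with rfl | h
    · exact Or.inr hab'
    by_cases hub : u = b
    · exact Or.inl hub
    exact Or.inr (not_exists_isMaxMatchableIn_trans hub
      (by rwa [missedIn_compl_gallaiEdmondsA]) h hab')
  exact key.resolve_right fun h => (h S hS).elim huS hvS

/-- A maximum matching of `G - A(G)` exposes `|Sᶜ| + |A(G)|` vertices; all lie in `D(G)`, in
distinct components. -/
theorem ncard_compl_add_ncard_gallaiEdmondsA_le [Finite V] {S : Set V}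
    (hS : G.IsMaxMatchableIn Set.univ S) :
    Sᶜ.ncard + G.gallaiEdmondsA.ncard ≤
      {X | G.IsInducedComponent G.gallaiEdmondsD X}.ncard := by
  obtain ⟨R, hR⟩ := G.exists_isMaxMatchableIn G.gallaiEdmondsAᶜ
  have h1 := hS.ncard_eq_add hR
  have hle : (G.gallaiEdmondsAᶜ \ R).ncard ≤
      {X | G.IsInducedComponent G.gallaiEdmondsD X}.ncard := by
    have hD : ∀ v ∈ G.gallaiEdmondsAᶜ \ R, v ∈ G.gallaiEdmondsD :=
      fun v hv => hR.mem_gallaiEdmondsD hv.1 hv.2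
    choose! f hf hvf using fun v hv => exists_isInducedComponent (G := G) (hD v hv)
    refine Set.ncard_le_ncard_of_injOn f hf (fun u hu v hv huv => ?_) (Set.toFinite _)
    exact hR.eq_of_notMem (hf u hu) (hvf u hu) (huv ▸ hvf v hv) hu.2 hv.2
  have h2 := Set.ncard_sdiff_add_ncard_of_subset hR.1
  have h3 := Set.ncard_add_ncard_compl S
  have h4 := Set.ncard_add_ncard_compl G.gallaiEdmondsA
  omega

/-- Components of `G[C(G)]` and of `G[D(G)]` are components of `G - A(G)`. -/
theorem mem_of_adj_of_notMem_gallaiEdmondsA {X : Set V}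
    (hX : G.IsInducedComponent G.gallaiEdmondsC X ∨ G.IsInducedComponent G.gallaiEdmondsD X)
    {u w : V} (hu : u ∈ X) (huw : G.Adj u w) (hw : w ∉ G.gallaiEdmondsA) : w ∈ X := by
  rcases hX with hX | hX
  · refine hX.mem_of_adj hu ?_ huw
    have huC := hX.subset hu
    rintro (hwD | hwA)
    · exact huC (Or.inr ⟨fun huD => huC (Or.inl huD), w, hwD, huw⟩)
    · exact hw hwA
  · refine hX.mem_of_adj hu ?_ huw
    by_contra hwD
    exact hw ⟨hwD, u, hX.subset hu, huw.symm⟩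

theorem IsMatchable.inter_component {S X : Set V} (hS : G.IsMatchable S)
    (hSA : S ⊆ G.gallaiEdmondsAᶜ)
    (hX : G.IsInducedComponent G.gallaiEdmondsC X ∨ G.IsInducedComponent G.gallaiEdmondsD X) :
    G.IsMatchable (X ∩ S) := by
  obtain ⟨M, hM, rfl⟩ := hS
  exact ⟨_, hM.induce_of_closed Set.inter_subset_right fun u w hu huw =>
    ⟨mem_of_adj_of_notMem_gallaiEdmondsA hX hu.1 huw.adj_sub (hSA huw.snd_mem), huw.snd_mem⟩, rfl⟩

/-- Some maximum matching of `G - A(G)` exposes a given vertex of `X`, hence no other, and matches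
the rest within `X`. -/
theorem IsInducedComponent.odd_ncard [Finite V] {X : Set V}
    (hX : G.IsInducedComponent G.gallaiEdmondsD X) : Odd X.ncard := by
  obtain ⟨x, hx⟩ := hX.nonempty
  have hxD := hX.subset hx
  rw [← missedIn_compl_gallaiEdmondsA] at hxD
  obtain ⟨-, S, hS, hxS⟩ := hxD
  have heq : X ∩ S = X \ {x} := by
    ext v
    constructor
    · rintro ⟨hvX, hvS⟩
      exact ⟨hvX, fun h => hxS (h ▸ hvS)⟩
    · rintro ⟨hvX, hvx⟩
      refine ⟨hvX, ?_⟩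
      by_contra hvS
      exact hvx (hS.eq_of_notMem hX hvX hx hvS hxS)
  have h := (hS.2.1.inter_component hS.1 (Or.inr hX)).even_ncard
  rw [heq] at h
  rw [← Set.ncard_sdiff_singleton_add_one hx (Set.toFinite _)]
  exact h.add_one

theorem IsMaxMatchableIn.exists_notMem [Finite V] {S X : Set V}
    (hS : G.IsMaxMatchableIn G.gallaiEdmondsAᶜ S)
    (hX : G.IsInducedComponent G.gallaiEdmondsD X) : ∃ v ∈ X, v ∉ S := by
  by_contra! hc
  have h := (hS.2.1.inter_component hS.1 (Or.inr hX)).even_ncard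
  rw [Set.inter_eq_left.2 hc] at h
  exact Nat.not_even_iff_odd.2 hX.odd_ncard h

/-! ### Matching edges that meet `A(G)` -/

/-- The vertices saturated by those edges of `M` that meet `A`. -/
def Subgraph.touching (M : G.Subgraph) (A : Set V) : Set V :=
  {v | ∃ w, M.Adj v w ∧ (v ∈ A ∨ w ∈ A)}

theorem Subgraph.touching_subset (M : G.Subgraph) (A : Set V) : M.touching A ⊆ M.verts :=
  fun _ ⟨_, h, _⟩ => h.fst_mem

theorem Subgraph.Adj.mem_touching {M : G.Subgraph} {A : Set V} {u w : V} (h : M.Adj u w)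
    (hA : u ∈ A ∨ w ∈ A) : u ∈ M.touching A := ⟨w, h, hA⟩

theorem Subgraph.IsMatching.adj_mem_touching {M : G.Subgraph} (hM : M.IsMatching) {A : Set V}
    {u w : V} (hu : u ∈ M.touching A) (huw : M.Adj u w) : w ∈ M.touching A := by
  obtain ⟨y, hy, hA⟩ := hu
  rw [hM.eq_of_adj_left hy huw] at hA
  exact ⟨u, huw.symm, hA.symm⟩

theorem Subgraph.IsMatching.induce_touching {M : G.Subgraph} (hM : M.IsMatching) (A : Set V) :
    (M.induce (M.touching A)).IsMatching :=
  hM.induce_of_closed (M.touching_subset A) fun _ _ => hM.adj_mem_touching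

theorem Subgraph.IsMatching.sdiff_touching {M : G.Subgraph} (hM : M.IsMatching) (A : Set V) :
    G.IsMatchable (M.verts \ M.touching A) :=
  ⟨_, hM.induce_of_closed Set.sdiff_subset fun _ _ hu huw =>
    ⟨huw.snd_mem, fun hw => hu.2 (hM.adj_mem_touching hw huw.symm)⟩, rfl⟩

theorem Subgraph.IsMatching.sdiff_touching_subset_compl {M : G.Subgraph} (hM : M.IsMatching)
    (A : Set V) : M.verts \ M.touching A ⊆ Aᶜ := by
  rintro v ⟨hv, hvt⟩ hvA
  obtain ⟨w, hw, -⟩ := hM hv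
  exact hvt (hw.mem_touching (Or.inl hvA))

/-- The edges of a maximum matching that meet `A(G)`. -/
theorem IsMaxMatchableIn.touching_gallaiEdmondsA [Finite V] {M : G.Subgraph} (hM : M.IsMatching)
    (hmax : G.IsMaxMatchableIn Set.univ M.verts) :
    G.IsMaxMatchableIn G.gallaiEdmondsAᶜ (M.verts \ M.touching G.gallaiEdmondsA) ∧
      (M.touching G.gallaiEdmondsA).ncard = 2 * G.gallaiEdmondsA.ncard ∧
      ∀ a ∈ G.gallaiEdmondsA, ∀ w, M.Adj a w → w ∈ G.gallaiEdmondsD := by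
  obtain ⟨R, hR⟩ := G.exists_isMaxMatchableIn G.gallaiEdmondsAᶜ
  have hRc := hmax.ncard_eq_add hR
  choose! p hp using fun v (hv : v ∈ M.verts) => (hM hv).exists
  -- This bounds the touched vertices by `2|A(G)|`, while the drop in maximum size after deleting
  -- `A(G)` forces at least that many. Equality makes the remaining edges maximum in `G - A(G)` and
  -- rules out edges inside `A(G)`.
  have htouch : M.touching G.gallaiEdmondsA ⊆
      G.gallaiEdmondsA ∪ p '' (G.gallaiEdmondsA ∩ M.verts) := by
    rintro v ⟨w, hvw, hv | hw⟩
    · exact Or.inl hv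
    · exact Or.inr ⟨w, ⟨hw, hvw.snd_mem⟩, hM.eq_of_adj_left (hp w hvw.snd_mem) hvw.symm⟩
  have hPcard : (p '' (G.gallaiEdmondsA ∩ M.verts)).ncard ≤ G.gallaiEdmondsA.ncard :=
    (Set.ncard_image_le (Set.toFinite _)).trans
      (Set.ncard_le_ncard Set.inter_subset_left (Set.toFinite _))
  have hU := Set.ncard_union_add_ncard_inter G.gallaiEdmondsA
    (p '' (G.gallaiEdmondsA ∩ M.verts))
  have ht := Set.ncard_le_ncard htouch (Set.toFinite _)
  have hdiff := Set.ncard_sdiff_add_ncard_of_subset (M.touching_subset G.gallaiEdmondsA)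
  have hle := hR.2.2 _ (hM.sdiff_touching_subset_compl _) (hM.sdiff_touching _)
  have hmax' : G.IsMaxMatchableIn G.gallaiEdmondsAᶜ (M.verts \ M.touching G.gallaiEdmondsA) :=
    hR.of_ncard_le (hM.sdiff_touching_subset_compl _) (hM.sdiff_touching _) (by omega)
  refine ⟨hmax', by omega, fun a ha w haw => hmax'.mem_gallaiEdmondsD (fun hw => ?_) fun hw =>
    hw.2 (haw.symm.mem_touching (Or.inr ha))⟩
  have h0 : (G.gallaiEdmondsA ∩ p '' (G.gallaiEdmondsA ∩ M.verts)).ncard = 0 := by omega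
  rw [Set.ncard_eq_zero (Set.toFinite _)] at h0
  exact h0.subset ⟨hw, a, ⟨ha, haw.fst_mem⟩, hM.eq_of_adj_left (hp a haw.fst_mem) haw⟩

theorem IsMaxMatchableIn.gallaiEdmondsA_subset [Finite V] {S : Set V}
    (hS : G.IsMaxMatchableIn Set.univ S) : G.gallaiEdmondsA ⊆ S := by
  intro a ha
  by_contra haS
  refine ha.1 ?_
  rw [gallaiEdmondsD_eq_missedIn_univ]
  exact ⟨trivial, S, hS, haS⟩

/-- Once the edges meeting `A(G)` are dropped, their ends in `D(G)` are exposed by a maximum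
matching of `G - A(G)`, so no two share a component. -/
theorem matchesAIntoDistinctDComponents_induce_touching [Finite V] {M : G.Subgraph}
    (hM : M.IsMatching) (hmax : G.IsMaxMatchableIn Set.univ M.verts) :
    G.MatchesAIntoDistinctDComponents (M.induce (M.touching G.gallaiEdmondsA)) := by
  obtain ⟨hR, hcard, hD⟩ := hmax.touching_gallaiEdmondsA hM
  have hN := hM.induce_touching G.gallaiEdmondsA
  have hedge : ∀ e : (M.induce (M.touching G.gallaiEdmondsA)).edgeSet,
      ∃ a ∈ G.gallaiEdmondsA, ∃ d, M.Adj a d ∧ (e : Sym2 V) = s(a, d) := by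
    rintro ⟨e, he⟩
    induction e with
    | _ u w =>
    obtain ⟨⟨y, huy, hA⟩, -, huw⟩ := Subgraph.mem_edgeSet.1 he
    rw [hM.eq_of_adj_left huy huw] at hA
    rcases hA with hA | hA
    · exact ⟨u, hA, w, huw, rfl⟩
    · exact ⟨w, hA, u, huw.symm, Sym2.eq_swap⟩
  choose a haA d had he using hedge
  choose X hX hdX using fun e => exists_isInducedComponent (G := G) (hD _ (haA e) _ (had e))
  have hdR : ∀ e, d e ∉ M.verts \ M.touching G.gallaiEdmondsA := fun e h =>
    h.2 ((had e).symm.mem_touching (Or.inr (haA e)))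
  refine ⟨?_, X, fun e f hef => ?_, fun e => ⟨hX e, a e, haA e, d e, hdX e, he e⟩⟩
  · have h := hN.two_mul_ncard_edgeSet
    rw [Subgraph.induce_verts, hcard] at h
    omega
  · have hd : d e = d f := hR.eq_of_notMem (hX e) (hdX e) (hef ▸ hdX f) (hdR e) (hdR f)
    have ha : a e = a f := hM.eq_of_adj_right (had e) (hd ▸ had f)
    exact Subtype.ext (by rw [he e, he f, ha, hd])

/-! ### The matching gap and the certificate in terms of matchable sets -/

theorem Subgraph.IsMatching.isMaximalMatching_iff {M : G.Subgraph} (hM : M.IsMatching) :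
    G.IsMaximalMatching M ↔ G.IsIndepSet M.vertsᶜ := by
  constructor
  · intro h u hu v hv _ huv
    have hN : (M ⊔ G.subgraphOfAdj huv).IsMatching := by
      refine hM.sup (.subgraphOfAdj huv) ?_
      rw [hM.support_eq_verts, (Subgraph.IsMatching.subgraphOfAdj huv).support_eq_verts,
        Set.disjoint_right]
      rintro w (rfl | rfl)
      exacts [hu, hv]
    exact hu ((h.2 hN le_sup_left).1 (Or.inr (Or.inl rfl)))
  · refine fun h => ⟨hM, fun N hN hMN => ?_⟩
    have hadj : ∀ u w, N.Adj u w → u ∈ M.verts → M.Adj u w := by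
      intro u w huw hu
      obtain ⟨y, hy, -⟩ := hM hu
      rwa [← hN.eq_of_adj_left (hMN.2 hy) huw]
    have hadj' : ∀ ⦃u w⦄, N.Adj u w → M.Adj u w := by
      intro u w huw
      by_cases hu : u ∈ M.verts
      · exact hadj u w huw hu
      · refine (hadj w u huw.symm ?_).symm
        by_contra hw
        exact h hu hw huw.ne huw.adj_sub
    refine ⟨fun v hv => ?_, hadj'⟩
    obtain ⟨w, hw, -⟩ := hN hv
    exact (hadj' hw).fst_mem

theorem IsMaxMatchableIn.two_mul_matchingNumber [Finite V] {T : Set V}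
    (hT : G.IsMaxMatchableIn Set.univ T) : 2 * G.matchingNumber = T.ncard := by
  obtain ⟨N, hN, rfl⟩ := hT.2.1
  rw [← hN.two_mul_ncard_edgeSet]
  congr 1
  refine IsGreatest.csSup_eq ⟨⟨N, hN, rfl⟩, ?_⟩
  rintro n ⟨M, hM, rfl⟩
  exact ((isMaximumMatching_iff hN).2 hT).2 M hM

theorem le_matchingGap_iff [Finite V] {T : Set V} (hT : G.IsMaxMatchableIn Set.univ T) {k : ℕ} :
    k ≤ G.matchingGap ↔
      ∃ S, G.IsMatchable S ∧ G.IsIndepSet Sᶜ ∧ S.ncard + 2 * k ≤ T.ncard := by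
  have hν := hT.two_mul_matchingNumber
  have hβν := G.minMaximalMatchingNumber_le_matchingNumber
  unfold matchingGap
  constructor
  · intro hk
    have hne : {n | ∃ M : G.Subgraph, G.IsMaximalMatching M ∧ M.edgeSet.ncard = n}.Nonempty := by
      obtain ⟨M, -, hM⟩ := (Set.toFinite {N : G.Subgraph | N.IsMatching}).exists_le_maximal
        (show (⊥ : G.Subgraph).IsMatching from fun v hv => by simp at hv)
      exact ⟨_, M, hM, rfl⟩
    obtain ⟨M, hM, hMβ⟩ := Nat.sInf_mem hne
    have hβ : M.edgeSet.ncard = G.minMaximalMatchingNumber := hMβ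
    refine ⟨M.verts, hM.1.isMatchable, hM.1.isMaximalMatching_iff.1 hM, ?_⟩
    rw [← hM.1.two_mul_ncard_edgeSet]
    omega
  · rintro ⟨_, ⟨M, hM, rfl⟩, hind, hle⟩
    rw [← hM.two_mul_ncard_edgeSet] at hle
    have hβ : G.minMaximalMatchingNumber ≤ M.edgeSet.ncard :=
      Nat.sInf_le ⟨M, hM.isMaximalMatching_iff.2 hind, rfl⟩
    omega

theorem IsMatchable.exists_isMatching_induce {Y Z : Set V} (hZ : G.IsMatchable Z) (hZY : Z ⊆ Y) :
    ∃ N : (G.induce Y).Subgraph, N.IsMatching ∧ N.verts = Subtype.val ⁻¹' Z := by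
  obtain ⟨M, hM, rfl⟩ := hZ
  refine ⟨M.comap (Embedding.induce Y).toHom, fun v hv => ?_, rfl⟩
  obtain ⟨w, hw, huniq⟩ := hM hv
  exact ⟨⟨w, hZY hw.snd_mem⟩, ⟨hw.adj_sub, hw⟩, fun y hy => Subtype.ext (huniq y hy.2)⟩

theorem isMatchable_image_val {Y : Set V} {N : (G.induce Y).Subgraph} (hN : N.IsMatching) :
    G.IsMatchable (Subtype.val '' N.verts) :=
  ⟨_, hN.map (Embedding.induce Y).toHom Subtype.val_injective, rfl⟩

theorem inducedHasPerfectMatching_iff {Y : Set V} :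
    G.InducedHasPerfectMatching Y ↔ G.IsMatchable Y := by
  constructor
  · rintro ⟨N, hN, hsp⟩
    have h := isMatchable_image_val hN
    rwa [Subgraph.isSpanning_iff.1 hsp, Set.image_univ, Subtype.range_val] at h
  · intro h
    obtain ⟨N, hN, hv⟩ := h.exists_isMatching_induce subset_rfl
    exact ⟨N, hN, fun v => hv ▸ v.2⟩

theorem Subgraph.IsMatching.isMatchable_component_sdiff {M : G.Subgraph} (hM : M.IsMatching)
    {X : Set V}
    (hX : G.IsInducedComponent G.gallaiEdmondsC X ∨ G.IsInducedComponent G.gallaiEdmondsD X) :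
    G.IsMatchable (X ∩ (M.verts \ M.touching G.gallaiEdmondsA)) :=
  (hM.sdiff_touching _).inter_component (hM.sdiff_touching_subset_compl _) hX

/-- Every edge of `M` meeting `A` has an end in `A \ I`, because `M` avoids `I`. A smaller matching
must cover that end, and inside `M` only the same edge does so. -/
theorem Subgraph.IsMatching.minimal_touching {M : G.Subgraph} (hM : M.IsMatching)
    {A I : Set V} (hA : A \ I ⊆ M.verts) (hI : Disjoint M.verts I) :
    Minimal (fun N : G.Subgraph => N.IsMatching ∧ A \ I ⊆ N.verts ∧ Disjoint N.verts I)
      (M.induce (M.touching A)) := by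
  refine ⟨⟨hM.induce_touching A, fun a ha => ?_, hI.mono_left (M.touching_subset A)⟩, ?_⟩
  · obtain ⟨w, hw, -⟩ := hM (hA ha)
    exact hw.mem_touching (Or.inl ha.1)
  · rintro N ⟨hN, hNA, -⟩ hle
    have key : ∀ u w, M.Adj u w → u ∈ A → N.Adj u w := by
      intro u w huw hu
      obtain ⟨y, hy, -⟩ := hN (hNA ⟨hu, Set.disjoint_left.1 hI huw.fst_mem⟩)
      rwa [← hM.eq_of_adj_left (hle.2 hy).2.2 huw]
    have key' : ∀ u w, M.Adj u w → u ∈ A ∨ w ∈ A → N.Adj u w := by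
      rintro u w huw (hu | hw)
      · exact key u w huw hu
      · exact (key w u huw.symm hw).symm
    refine ⟨?_, ?_⟩
    · rintro v ⟨w, hvw, hA⟩
      exact (key' v w hvw hA).fst_mem
    · rintro u w ⟨⟨y, huy, hA⟩, -, huw⟩
      rw [hM.eq_of_adj_left huy huw] at hA
      exact key' u w huw hA

/-- A vertex of `D(G)` saturated by `N` can only be the `D(G)`-end of its edge, so each component
met is the one assigned to an edge. -/
theorem MatchesAIntoDistinctDComponents.ncard_components_le [Finite V] {N : G.Subgraph}
    (hN : N.IsMatching) (h : G.MatchesAIntoDistinctDComponents N) :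
    {X | G.IsInducedComponent G.gallaiEdmondsD X ∧ (X ∩ N.verts).Nonempty}.ncard ≤
      G.gallaiEdmondsA.ncard := by
  obtain ⟨hcard, X, -, hX⟩ := h
  rw [← hcard]
  calc _ ≤ (X '' Set.univ).ncard := Set.ncard_le_ncard ?_ (Set.toFinite _)
    _ ≤ (Set.univ : Set N.edgeSet).ncard := Set.ncard_image_le (Set.toFinite _)
    _ = N.edgeSet.ncard := by rw [Set.ncard_univ, Nat.card_coe_set_eq]
  rintro Y ⟨hY, y, hyY, hyN⟩
  obtain ⟨w, hw, -⟩ := hN hyN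
  obtain ⟨hXe, a, ha, d, hd, he⟩ := hX ⟨s(y, w), hw⟩
  refine ⟨⟨s(y, w), hw⟩, trivial, hXe.eq_of_mem hY hd ?_⟩
  have hya : y ≠ a := fun h => ha.1 (h ▸ hY.subset hyY)
  rcases Sym2.eq_iff.1 he with ⟨h, -⟩ | ⟨h, -⟩
  · exact absurd h hya
  · exact h ▸ hyY

end SimpleGraph

/-! ### The main equivalence -/

theorem mainTheorem7 {V : Type*} [Finite V] (G : SimpleGraph V) (k : ℕ) :
    k ≤ G.matchingGap ↔
      ∃ (I : Set V) (MA MAstar : G.Subgraph),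
        G.IsIndepSet I ∧ MA.IsMatching ∧ MAstar.IsMatching ∧
        I.ncard = 2 * k ∧
        Minimal (fun N : G.Subgraph =>
          N.IsMatching ∧ G.gallaiEdmondsA \ I ⊆ N.verts ∧ Disjoint N.verts I) MA ∧
        G.MatchesAIntoDistinctDComponents MAstar ∧
        (∀ X : Set V,
          (G.IsInducedComponent G.gallaiEdmondsC X ∨
            (G.IsInducedComponent G.gallaiEdmondsD X ∧ (X ∩ MAstar.verts).Nonempty)) →
          G.InducedHasPerfectMatching (X \ (I ∪ MA.verts))) ∧
        (∀ X : Set V,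
          G.IsInducedComponent G.gallaiEdmondsD X → X ∩ MAstar.verts = ∅ →
          ∃ (MX : (G.induce (X \ (I ∪ MA.verts))).Subgraph)
            (v : ↥(X \ (I ∪ MA.verts))),
            MX.IsMatching ∧ MX.vertsᶜ = {v} ∧ G.neighborSet (v : V) ∩ I = ∅) := by
  constructor
  · intro hk
    obtain ⟨T₀, hT₀⟩ := G.exists_isMaxMatchableIn Set.univ
    obtain ⟨S₀, hS₀, hind₀, hcard₀⟩ := (SimpleGraph.le_matchingGap_iff hT₀).1 hk
    obtain ⟨T, hT, hS₀T⟩ := hS₀.exists_isMaxMatchableIn_superset (Set.subset_univ _)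
    rw [hT₀.ncard_eq hT] at hcard₀
    obtain ⟨q, hq⟩ := hT.2.1.even_ncard
    obtain ⟨S, hS, hS₀S, hST, hScard⟩ := hS₀.exists_superset_ncard_eq hT.2.1 hS₀T
      (m := T.ncard - 2 * k) ⟨q - k, by omega⟩ (by omega) (by omega)
    have hind : G.IsIndepSet Sᶜ := hind₀.mono (Set.compl_subset_compl.2 hS₀S)
    obtain ⟨M, hM, rfl⟩ := hS
    have hTM := hT.2.1
    obtain ⟨N, hN, rfl⟩ := hTM
    have hAN := hT.gallaiEdmondsA_subset
    obtain ⟨hR, -, -⟩ := hT.touching_gallaiEdmondsA hN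
    have hIM : Disjoint M.verts (N.verts \ M.verts) := Set.disjoint_sdiff_right
    have hmin := hM.minimal_touching (A := G.gallaiEdmondsA) (I := N.verts \ M.verts)
      (fun a ha => by have := hAN ha.1; by_contra h; exact ha.2 ⟨this, h⟩) hIM
    have hsub := M.touching_subset G.gallaiEdmondsA
    refine ⟨N.verts \ M.verts, M.induce (M.touching G.gallaiEdmondsA),
      N.induce (N.touching G.gallaiEdmondsA), hind.mono fun v hv => hv.2,
      hM.induce_touching _, hN.induce_touching _, ?_, hmin,
      SimpleGraph.matchesAIntoDistinctDComponents_induce_touching hN hT, ?_, ?_⟩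
    · have := Set.ncard_sdiff_add_ncard_of_subset hST
      omega
    · intro X hX
      have hX' := hX.imp_right And.left
      rw [SimpleGraph.inducedHasPerfectMatching_iff]
      -- Exposed vertices lie in `D(G)`, which settles components of `G[C(G)]`. In a component of
      -- `G[D(G)]` met by `M_A^*`, the single vertex missed after dropping the edges at `A(G)` is
      -- the one `M_A^*` saturates.
      have hXN : X ⊆ N.verts := by
        intro v hv
        by_contra hvN
        rcases hX with hX | ⟨hX, u, hu, huN⟩
        · exact hX.subset hv (Or.inl (hR.mem_gallaiEdmondsD (fun h => hvN (hAN h))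
            fun h => hvN h.1))
        · have := hR.eq_of_notMem hX hv hu (fun h => hvN h.1) (fun h => h.2 huN)
          exact hvN (this ▸ N.touching_subset _ huN)
      convert hM.isMatchable_component_sdiff hX' using 1
      ext v
      simp only [SimpleGraph.Subgraph.induce_verts, Set.mem_sdiff, Set.mem_union, Set.mem_inter_iff]
      have := @hXN v
      tauto
    · intro X hX hXN
      obtain ⟨v, hvX, hvR⟩ := hR.exists_notMem hX
      have hvN : v ∉ N.verts := fun h => hvR ⟨h, fun ht => hXN.subset ⟨hvX, ht⟩⟩
      have hvM : v ∉ M.verts := fun h => hvN (hST h)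
      have huniq : ∀ w ∈ X, w ∉ N.verts → w = v := fun w hw hwN =>
        hR.eq_of_notMem hX hw hvX (fun h => hwN h.1) hvR
      have hvY : v ∈ X \ (N.verts \ M.verts ∪ M.touching G.gallaiEdmondsA) :=
        ⟨hvX, fun h => h.elim (fun h => hvN h.1) fun h => hvM (hsub h)⟩
      obtain ⟨MX, hMX, hverts⟩ :=
        (hM.isMatchable_component_sdiff (Or.inr hX)).exists_isMatching_induce
          (Y := X \ (N.verts \ M.verts ∪ M.touching G.gallaiEdmondsA))
          (fun w hw => ⟨hw.1, fun h => h.elim (fun h => h.2 hw.2.1) hw.2.2⟩)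
      refine ⟨MX, ⟨v, hvY⟩, hMX, ?_, ?_⟩
      · rw [hverts]
        ext ⟨w, hwX, hw⟩
        refine Iff.trans ?_ Subtype.ext_iff.symm
        constructor
        · intro h
          refine huniq w hwX fun hwN => h ⟨hwX, ?_, fun ht => hw (Or.inr ht)⟩
          by_contra hwM
          exact hw (Or.inl ⟨hwN, hwM⟩)
        · rintro rfl h
          exact hvM h.2.1
      · rw [Set.eq_empty_iff_forall_notMem]
        rintro w ⟨hvw, hwI⟩
        exact hind hvM hwI.2 (G.ne_of_adj hvw) hvw
  · rintro ⟨I, MA, MAstar, hI, hMA, hMAstar, hIcard, hmin, hstar, hgood, hbad⟩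
    -- Nonemptiness supplies the default value for `choose!` below.
    rcases isEmpty_or_nonempty V with _ | _
    · have : k = 0 := by simpa [Set.eq_empty_of_isEmpty I] using hIcard
      exact this ▸ Nat.zero_le _
    obtain ⟨T, hT⟩ := G.exists_isMaxMatchableIn Set.univ
    rw [SimpleGraph.le_matchingGap_iff hT]
    let B : Set (Set V) :=
      {X | G.IsInducedComponent G.gallaiEdmondsD X ∧ X ∩ MAstar.verts = ∅}
    have hbad' : ∀ X ∈ B, ∃ v ∈ X, v ∉ I ∧ v ∉ MA.verts ∧ (∀ w ∈ I, ¬ G.Adj v w) ∧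
        G.IsMatchable ((X \ (I ∪ MA.verts)) \ {v}) := by
      rintro X ⟨hX, hXe⟩
      obtain ⟨MX, ⟨v, hvX, hv⟩, hMX, hverts, hvI⟩ := hbad X hX hXe
      refine ⟨v, hvX, fun h => hv (Or.inl h), fun h => hv (Or.inr h),
        fun w hw hvw => hvI.subset ⟨hvw, hw⟩, ?_⟩
      convert SimpleGraph.isMatchable_image_val hMX using 1
      rw [← compl_compl MX.verts, hverts]
      ext w
      simp [and_comm]
    choose! f hfX hfI hfMA hfadj hfmatch using hbad'
    have hfD : ∀ X ∈ B, f X ∈ G.gallaiEdmondsD := fun X hX => hX.1.subset (hfX X hX)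
    have hfinj : Set.InjOn f B := fun X hX Y hY h =>
      hX.1.eq_of_mem hY.1 (hfX X hX) (h ▸ hfX Y hY)
    -- Expose exactly `I` and one vertex `v_X` per component unmet by `M_A^*`.
    refine ⟨(I ∪ f '' B)ᶜ, ?_, ?_, ?_⟩
    · let comps : Set (Set V) :=
        {X | G.IsInducedComponent G.gallaiEdmondsC X ∨ G.IsInducedComponent G.gallaiEdmondsD X}
      have hpiece : ∀ X : comps, G.IsMatchable ((X \ (I ∪ MA.verts)) \ f '' B) := by
        rintro ⟨X, hX⟩
        by_cases hXB : X ∈ B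
        · convert hfmatch X hXB using 1
          ext v
          refine and_congr_right fun hv => not_congr ⟨?_, ?_⟩
          · rintro ⟨Y, hY, rfl⟩
            rw [hXB.1.eq_of_mem hY.1 hv.1 (hfX Y hY)]
            rfl
          · rintro rfl
            exact ⟨X, hXB, rfl⟩
        · have hX' : G.IsInducedComponent G.gallaiEdmondsC X ∨
              (G.IsInducedComponent G.gallaiEdmondsD X ∧ (X ∩ MAstar.verts).Nonempty) :=
            hX.imp_right fun h => ⟨h, Set.nonempty_iff_ne_empty.2 fun he => hXB ⟨h, he⟩⟩
          have h := SimpleGraph.inducedHasPerfectMatching_iff.1 (hgood X hX')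
          rwa [← sdiff_eq_left.2 (?_ : Disjoint (X \ (I ∪ MA.verts)) (f '' B))] at h
          rw [Set.disjoint_left]
          rintro _ hv ⟨Y, hY, rfl⟩
          rcases hX with hX | hX
          · exact hX.subset hv.1 (Or.inl (hfD Y hY))
          · exact hXB (hX.eq_of_mem hY.1 hv.1 (hfX Y hY) ▸ hY)
      have hcompsdisj : ∀ X ∈ comps, ∀ Y ∈ comps, ∀ v, v ∈ X → v ∈ Y → X = Y := by
        rintro X (hX | hX) Y (hY | hY) v hvX hvY
        · exact hX.eq_of_mem hY hvX hvY
        · exact absurd (Or.inl (hY.subset hvY)) (hX.subset hvX)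
        · exact absurd (Or.inl (hX.subset hvX)) (hY.subset hvY)
        · exact hX.eq_of_mem hY hvX hvY
      have hunion := SimpleGraph.IsMatchable.iUnion hpiece fun X Y hXY =>
        Set.disjoint_left.2 fun v hvX hvY => hXY (Subtype.ext (hcompsdisj X X.2 Y Y.2 v hvX.1.1 hvY.1.1))
      convert hMA.isMatchable.union hunion ?_ using 1
      · ext v
        constructor
        · intro hv
          by_cases hvMA : v ∈ MA.verts
          · exact Or.inl hvMA
          refine Or.inr (Set.mem_iUnion.2 ?_)
          obtain ⟨X, hX, hvX⟩ : ∃ X ∈ comps, v ∈ X := by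
            by_cases hvD : v ∈ G.gallaiEdmondsD
            · obtain ⟨X, hX, hvX⟩ := SimpleGraph.exists_isInducedComponent (G := G) hvD
              exact ⟨X, Or.inr hX, hvX⟩
            · have hvC : v ∈ G.gallaiEdmondsC := by
                rintro (h | h)
                · exact hvD h
                · exact hvMA (hmin.1.2.1 ⟨h, fun hvI => hv (Or.inl hvI)⟩)
              obtain ⟨X, hX, hvX⟩ := SimpleGraph.exists_isInducedComponent (G := G) hvC
              exact ⟨X, Or.inl hX, hvX⟩
          exact ⟨⟨X, hX⟩, ⟨hvX, fun h => h.elim (fun h => hv (Or.inl h)) hvMA⟩,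
            fun h => hv (Or.inr h)⟩
        · rintro (hv | hv)
          · rintro (h | ⟨X, hX, rfl⟩)
            · exact Set.disjoint_left.1 hmin.1.2.2 hv h
            · exact hfMA X hX hv
          · obtain ⟨X, hX, hvB⟩ := Set.mem_iUnion.1 hv
            exact fun h => h.elim (fun h => hX.2 (Or.inl h)) hvB
      · rw [Set.disjoint_iUnion_right]
        exact fun X => Set.disjoint_left.2 fun v hv h => h.1.2 (Or.inr hv)
    · rw [compl_compl]
      rintro u (hu | ⟨X, hX, rfl⟩) v (hv | ⟨Y, hY, rfl⟩) huv hadj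
      · exact hI hu hv huv hadj
      · exact hfadj Y hY u hu hadj.symm
      · exact hfadj X hX v hv hadj
      -- Two adjacent vertices of `D(G)` share a component, and each component contributes only one
      -- `v_X`.
      · have := hX.1.mem_of_adj (hfX X hX) (hfD Y hY) hadj
        exact huv (congrArg f (hX.1.eq_of_mem hY.1 this (hfX Y hY)))
    · have h1 : (I ∪ f '' B).ncard = 2 * k + B.ncard := by
        rw [Set.ncard_union_eq ?_ (Set.toFinite _) (Set.toFinite _), hIcard,
          hfinj.ncard_image]
        rw [Set.disjoint_right]
        rintro _ ⟨X, hX, rfl⟩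
        exact hfI X hX
      have h2 := SimpleGraph.ncard_compl_add_ncard_gallaiEdmondsA_le hT
      have h3 := hstar.ncard_components_le hMAstar
      -- At most `|A(G)|` components are met by `M_A^*`, so `|B|` is at least the number of vertices
      -- exposed by `T`.
      have h4 : {X | G.IsInducedComponent G.gallaiEdmondsD X}.ncard ≤
          B.ncard + {X | G.IsInducedComponent G.gallaiEdmondsD X ∧
            (X ∩ MAstar.verts).Nonempty}.ncard := by
        refine (Set.ncard_le_ncard (fun X hX => ?_) (Set.toFinite _)).trans (Set.ncard_union_le _ _)
        rcases (X ∩ MAstar.verts).eq_empty_or_nonempty with h | h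
        · exact Or.inl ⟨hX, h⟩
        · exact Or.inr ⟨hX, h⟩
      have h5 := Set.ncard_add_ncard_compl T
      have h6 := Set.ncard_add_ncard_compl (I ∪ f '' B)
      omega
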